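/- Let $p$ be a prime, let $K$ be a field of characteristic $p$, and let $L$ be a finite-dimensional Lie $p$-algebra (restricted Lie algebra) over $K$ with $p$-map $x\mapsto x^{[p]}$. Let $u(L)$ be its restricted universal enveloping algebra, i.e. the quotient of the universal enveloping algebra $U(L)$ by the two-sided ideal generated by the elements $x^p-x^{[p]}$, $x\in L$. The restricted cohomological dimension $\operatorname{cd}_*(L)$ is the minimal $n$ such that the trivial right $u(L)$-module $K$ has a resolution $0\to P_n\to\dots\to P_1\to P_0\to K\to 0$ by projective right $u(L)$-modules, and $\operatorname{cd}_*(L)=\infty$ if there is no such finite resolution. Then either $\operatorname{cd}_*(L)=0$ or $\operatorname{cd}_*(L)=\infty$. -/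

import Mathlib

/-!
Lie `p`-algebras, their restricted universal enveloping algebras, and restricted
cohomological dimension.
-/

open CategoryTheory

universe u v

noncomputable section

/-- Jacobson's Lie polynomial `sᵢ(x, y)`: the element such that `i • sᵢ(x, y)` is the coefficient of
`t ^ (i - 1)` in `ad (t x + y) ^ (p - 1) (x)`, for `1 ≤ i ≤ p - 1`. Here `t` is the central variable
`Polynomial.X` of the polynomial ring over the (noncommutative) ring `End_K(L)`. -/
def jacobsonTerm (p : ℕ) (K : Type u) {L : Type v} [Field K] [LieRing L] [LieAlgebra K L]
    (i : ℕ) (x y : L) : L :=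
  (i : K)⁻¹ •
    (((Polynomial.C (LieAlgebra.ad K L x) * Polynomial.X +
      Polynomial.C (LieAlgebra.ad K L y)) ^ (p - 1)).coeff (i - 1)) x

/-- A Lie `p`-algebra (restricted Lie algebra) structure on a Lie algebra `L` over a field `K`
of characteristic `p`: a `p`-map `x ↦ x^[p]` satisfying Jacobson's three axioms. -/
class LiePAlgebra (p : ℕ) (K : Type u) (L : Type v) [Field K] [CharP K p]
    [LieRing L] [LieAlgebra K L] where
  /-- The `p`-map `x ↦ x^[p]`. -/
  pMap : L → L
  ad_pMap : ∀ x : L, LieAlgebra.ad K L (pMap x) = LieAlgebra.ad K L x ^ p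
  pMap_smul : ∀ (a : K) (x : L), pMap (a • x) = a ^ p • pMap x
  pMap_add : ∀ x y : L,
    pMap (x + y) = pMap x + pMap y + ∑ i ∈ Finset.Ico 1 p, jacobsonTerm p K i x y

namespace LiePAlgebra

variable (p : ℕ) (K : Type u) (L : Type v) [Field K] [CharP K p]
  [LieRing L] [LieAlgebra K L] [LiePAlgebra p K L]

/-- The relations `x ^ p = x^[p]`, `x ∈ L`, in the universal enveloping algebra `U(L)`. -/
inductive RestrictedRel :
    UniversalEnvelopingAlgebra K L → UniversalEnvelopingAlgebra K L → Prop
  | pow_eq (x : L) : RestrictedRel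
      (UniversalEnvelopingAlgebra.ι K x ^ p)
      (UniversalEnvelopingAlgebra.ι K (pMap p K x))

/-- The restricted universal enveloping algebra `u(L)`: the quotient of `U(L)` by the two-sided
ideal generated by the elements `x ^ p - x^[p]`, `x ∈ L`. -/
abbrev RestrictedEnveloping : Type (max u v) := RingQuot (RestrictedRel p K L)

section Augmentation

attribute [local instance] LieRing.ofAssociativeRing

/-- The augmentation `u(L) → K`, the algebra homomorphism that annihilates the image of `L`. -/
def augmentation [Fact p.Prime] : RestrictedEnveloping p K L →ₐ[K] K :=
  RingQuot.liftAlgHom K ⟨UniversalEnvelopingAlgebra.lift K (0 : L →ₗ⁅K⁆ K), by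
    rintro _ _ ⟨x⟩
    simp [(Fact.out : p.Prime).ne_zero]⟩

end Augmentation

/-- The trivial right `u(L)`-module `K` (right modules are modules over the opposite ring). The
field is lifted to the universe of `u(L)`, so that all free modules are in the category. -/
def trivialModule [Fact p.Prime] :
    ModuleCat.{max u v} (RestrictedEnveloping p K L)ᵐᵒᵖ :=
  (ModuleCat.restrictScalars
    ((augmentation p K L : RestrictedEnveloping p K L →+* K).fromOpposite
      (fun _ _ => Commute.all _ _))).obj (ModuleCat.of K (ULift.{v} K))

/-- The trivial module has a resolution `0 → Pₙ → ⋯ → P₁ → P₀ → K → 0` by projective right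
`u(L)`-modules. -/
def HasResolutionOfLength [Fact p.Prime] (n : ℕ) : Prop :=
  ∃ P : ProjectiveResolution (trivialModule p K L),
    ∀ i : ℕ, n < i → Limits.IsZero (P.complex.X i)

/-- The restricted cohomological dimension `cd_*(L)`: the minimal length of a finite projective
resolution of the trivial module `K` over `u(L)`, or `⊤` if there is no such resolution. -/
def restrictedCohomologicalDimension [Fact p.Prime] : ℕ∞ :=
  ⨅ (n : ℕ) (_ : HasResolutionOfLength p K L n), (n : ℕ∞)

end LiePAlgebra

end

/-!
The algebra `u(L)` is finite-dimensional, and it is generated by `L`, whose elements are primitive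
for the comultiplication `x ↦ x ⊗ 1 + 1 ⊗ x`. Such an algebra is self-injective, so projective
modules are injective, and every finite projective resolution splits from its left end. Hence the
trivial module is projective as soon as it has a finite projective resolution.

Self-injectivity (`Algebra.baer_of_adjoin_primitive`) is proved without antipode or integrals. Let
`A` be a finite-dimensional algebra generated by primitive elements. The space `End_K(A)` carries
two commuting actions of `A`, namely `(a • f)(x) = f (x * a)`, which is coinduced, hence injective,
and `(a • f)(x) = a * f x`, which is free. The comultiplication combines them into a diagonal
action. The freeness of the second action and the universal property of the first yield
equivariant maps
  `values → diagonal → coinduced`.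
By induction along products of primitive elements, the first map is surjective
(`Algebra.valueToDiagonal_surjective`) and the second one is injective
(`Algebra.diagonalToCoinduced_injective`). As all three spaces have the same finite dimension, both
maps are isomorphisms, so that a free module with the summand `A` is injective.

Only the elementary half of the Poincaré–Birkhoff–Witt theorem is needed: a long product of basis
elements of `L` contains some factor `p` times; modulo shorter products the factors commute, and
the `p`-th power of that factor is again in `L`
(`Algebra.finiteDimensional_of_commutator_of_pow`). Right modules are modules over the opposite
algebra, which inherits the comultiplication.
-/

/-! ### Finite projective resolutions when projective objects are injective -/

namespace CategoryTheory

variable {C : Type u} [Category.{v} C] [Abelian C]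

/-- Since `Ext` is computed by a projective resolution, a resolution that vanishes above
degree `n` bounds the projective dimension by `n`. -/
theorem ProjectiveResolution.hasProjectiveDimensionLE {Z : C} (P : ProjectiveResolution Z) {n : ℕ}
    (hP : ∀ i : ℕ, n < i → Limits.IsZero (P.complex.X i)) : HasProjectiveDimensionLE Z n := by
  let := HasExt.standard C
  refine HasProjectiveDimensionLT.mk fun i hi Y e ↦ ?_
  obtain ⟨f, hf, rfl⟩ := P.extMk_surjective e (i + 1) rfl
  obtain rfl := (hP i hi).eq_of_src f 0
  exact P.extMk_zero _ _

/-- If projective objects are injective, finite projective dimension implies projectivity: by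
induction the kernel of an epimorphism `P ⟶ X` with `P` projective is projective, hence injective,
so that the epimorphism splits. -/
theorem projective_of_hasProjectiveDimensionLE [EnoughProjectives C]
    (hC : ∀ P : C, Projective P → Injective P) {n : ℕ} {X : C}
    (hX : HasProjectiveDimensionLE X n) : Projective X := by
  induction n generalizing X with
  | zero => exact projective_iff_hasProjectiveDimensionLT_one.mpr hX
  | succ n ih =>
    obtain ⟨p⟩ := EnoughProjectives.presentation X
    let S := ShortComplex.mk _ _ (Limits.kernel.condition p.f)
    have hS : S.ShortExact := { exact := ShortComplex.exact_kernel p.f }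
    have : Projective S.X₁ := ih ((hS.hasProjectiveDimensionLT_X₃_iff n p.projective).mp hX)
    have : Injective S.X₁ := hC _ this
    let s := hS.splittingOfInjective
    have : Projective S.X₂ := p.projective
    exact (Retract.mk s.s S.g s.s_g).projective

end CategoryTheory

open scoped TensorProduct

/-! ### Self-injectivity of algebras generated by primitive elements -/

namespace Algebra

variable {K : Type*} [Field K] {A : Type*} [Ring A] [Algebra K A]

theorem submodule_eq_top_of_mul_mem_left {S : Set A} (hS : adjoin K S = ⊤) {N : Submodule K A}
    (h1 : 1 ∈ N) (hN : ∀ s ∈ S, ∀ a ∈ N, s * a ∈ N) : N = ⊤ := by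
  have key : ∀ b : A, ∀ a ∈ N, b * a ∈ N := by
    intro b
    have hb : b ∈ adjoin K S := hS ▸ mem_top
    induction hb using adjoin_induction with
    | mem s hs => exact hN s hs
    | algebraMap r => intro a ha; rw [← smul_def]; exact N.smul_mem r ha
    | add x y _ _ hx hy => intro a ha; rw [add_mul]; exact N.add_mem (hx a ha) (hy a ha)
    | mul x y _ _ hx hy => intro a ha; rw [mul_assoc]; exact hx _ (hy a ha)
  exact (Submodule.eq_top_iff'.mpr fun b ↦ by simpa using key b 1 h1)

theorem submodule_eq_top_of_mul_mem_right {S : Set A} (hS : adjoin K S = ⊤) {N : Submodule K A}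
    (h1 : 1 ∈ N) (hN : ∀ s ∈ S, ∀ a ∈ N, a * s ∈ N) : N = ⊤ := by
  have key : ∀ b : A, ∀ a ∈ N, a * b ∈ N := by
    intro b
    have hb : b ∈ adjoin K S := hS ▸ mem_top
    induction hb using adjoin_induction with
    | mem s hs => exact hN s hs
    | algebraMap r => intro a ha; rw [← commutes, ← smul_def]; exact N.smul_mem r ha
    | add x y _ _ hx hy => intro a ha; rw [mul_add]; exact N.add_mem (hx a ha) (hy a ha)
    | mul x y _ _ hx hy => intro a ha; rw [← mul_assoc]; exact hy _ (hx a ha)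
  exact (Submodule.eq_top_iff'.mpr fun b ↦ by simpa using key b 1 h1)

variable (K A) in
/-- The coinduced action of `A` on `End_K(A)`: `(a • f)(x) = f (x * a)`. -/
noncomputable def coinducedAction : A →ₐ[K] Module.End K (Module.End K A) :=
  AlgHom.ofLinearMap ((LinearMap.mul K (Module.End K A)).flip ∘ₗ (LinearMap.mul K A).flip)
    (by ext; simp) (by intros; ext; simp [mul_assoc])

@[simp]
theorem coinducedAction_apply (a : A) (f : Module.End K A) (x : A) :
    coinducedAction K A a f x = f (x * a) := rfl

variable (K A) in
/-- The action of `A` on `End_K(A)` by left multiplication on values: `(a • f)(x) = a * f x`. -/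
noncomputable def valueAction : A →ₐ[K] Module.End K (Module.End K A) :=
  (lmul K (Module.End K A)).comp (lmul K A)

@[simp]
theorem valueAction_apply (a : A) (f : Module.End K A) (x : A) :
    valueAction K A a f x = a * f x := rfl

theorem commute_coinducedAction_valueAction (a b : A) :
    Commute (coinducedAction K A a) (valueAction K A b) := rfl

/-- The diagonal action of `A` on `End_K(A)` for a comultiplication `Δ`: a primitive
element `s` acts by `(s • f)(x) = f (x * s) + s * f x`. -/
noncomputable def diagonalAction (Δ : A →ₐ[K] A ⊗[K] A) : A →ₐ[K] Module.End K (Module.End K A) :=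
  (TensorProduct.lift (coinducedAction K A) (valueAction K A)
    commute_coinducedAction_valueAction).comp Δ

theorem diagonalAction_apply_of_primitive {Δ : A →ₐ[K] A ⊗[K] A} {s : A}
    (hs : Δ s = s ⊗ₜ 1 + 1 ⊗ₜ s) (f : Module.End K A) (x : A) :
    diagonalAction Δ s f x = f (x * s) + s * f x := by
  rw [diagonalAction, AlgHom.comp_apply, hs, map_add, TensorProduct.lift_tmul,
    TensorProduct.lift_tmul]
  simp

/-- The map from the diagonal to the coinduced action that corresponds to evaluation at `1`. -/
noncomputable def diagonalToCoinduced (Δ : A →ₐ[K] A ⊗[K] A) :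
    Module.End K A →ₗ[K] Module.End K A :=
  LinearMap.mk₂ K (fun f h ↦ diagonalAction Δ h f 1) (by simp) (by simp) (by simp) (by simp)

@[simp]
theorem diagonalToCoinduced_apply (Δ : A →ₐ[K] A ⊗[K] A) (f : Module.End K A) (h : A) :
    diagonalToCoinduced Δ f h = diagonalAction Δ h f 1 := rfl

theorem diagonalToCoinduced_diagonalAction (Δ : A →ₐ[K] A ⊗[K] A) (a : A) (f : Module.End K A) :
    diagonalToCoinduced Δ (diagonalAction Δ a f) =
      coinducedAction K A a (diagonalToCoinduced Δ f) := by
  ext h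
  simp

/-- The kernel is stable under the diagonal action and consists of functions vanishing at `1`;
hence its elements vanish on all products of primitive elements. -/
theorem diagonalToCoinduced_injective {Δ : A →ₐ[K] A ⊗[K] A}
    (hΔ : adjoin K {s : A | Δ s = s ⊗ₜ 1 + 1 ⊗ₜ s} = ⊤) :
    Function.Injective (diagonalToCoinduced Δ) := by
  rw [← LinearMap.ker_eq_bot, LinearMap.ker_eq_bot']
  let N : Submodule K A := ⨅ f : LinearMap.ker (diagonalToCoinduced Δ), LinearMap.ker f.1
  have hN : ∀ x, x ∈ N ↔ ∀ f : Module.End K A, diagonalToCoinduced Δ f = 0 → f x = 0 := by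
    simp [N]
  have h1 : (1 : A) ∈ N := by
    rw [hN]
    intro f hf
    simpa using LinearMap.congr_fun hf 1
  have hmul : ∀ s ∈ {s : A | Δ s = s ⊗ₜ 1 + 1 ⊗ₜ s}, ∀ a ∈ N, a * s ∈ N := by
    intro s hs a ha
    rw [hN] at ha ⊢
    intro f hf
    have h := ha (diagonalAction Δ s f) (by
      rw [diagonalToCoinduced_diagonalAction, hf, map_zero])
    rwa [diagonalAction_apply_of_primitive hs, ha f hf, mul_zero, add_zero] at h
  have htop := submodule_eq_top_of_mul_mem_right hΔ h1 hmul
  intro f hf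
  ext x
  exact (hN x).mp (htop ▸ Submodule.mem_top) f hf

variable [FiniteDimensional K A]

/-- The map from the action on values to the diagonal action. The former is free on the functionals
`φ`, regarded as maps `φ(·) 1`, and this map is the identity on these generators. -/
noncomputable def valueToDiagonal (Δ : A →ₐ[K] A ⊗[K] A) : Module.End K A →ₗ[K] Module.End K A where
  toFun f := ∑ i, diagonalAction Δ (f (Module.finBasis K A i))
    (((Module.finBasis K A).coord i).smulRight 1)
  map_add' f g := by simp [Finset.sum_add_distrib]
  map_smul' c f := by simp [Finset.smul_sum]

theorem valueToDiagonal_valueAction (Δ : A →ₐ[K] A ⊗[K] A) (a : A) (f : Module.End K A) :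
    valueToDiagonal Δ (valueAction K A a f) = diagonalAction Δ a (valueToDiagonal Δ f) := by
  simp [valueToDiagonal]

/-- The value on generators, which `valueToDiagonal` prescribes only for the coordinate functionals,
holds for all functionals by linearity. -/
theorem valueToDiagonal_smulRight (Δ : A →ₐ[K] A ⊗[K] A) (φ : A →ₗ[K] K) (a : A) :
    valueToDiagonal Δ (φ.smulRight a) = diagonalAction Δ a (φ.smulRight 1) := by
  have hφ : (φ.smulRight 1 : Module.End K A) = ∑ i, φ (Module.finBasis K A i) •
      (((Module.finBasis K A).coord i).smulRight (1 : A)) := by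
    refine (Module.finBasis K A).ext fun j ↦ ?_
    simp [Finsupp.single_apply]
  rw [hφ]
  simp [valueToDiagonal]

/-- The range contains `φ(·) 1` for every functional `φ` and is stable under the diagonal action;
hence it contains `φ(·) a` for all `φ` and all products `a` of primitive elements. -/
theorem valueToDiagonal_surjective {Δ : A →ₐ[K] A ⊗[K] A}
    (hΔ : adjoin K {s : A | Δ s = s ⊗ₜ 1 + 1 ⊗ₜ s} = ⊤) :
    Function.Surjective (valueToDiagonal Δ) := by
  let R := LinearMap.range (valueToDiagonal Δ)
  have hR : ∀ a, ∀ f ∈ R, diagonalAction Δ a f ∈ R := by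
    rintro a _ ⟨f, rfl⟩
    exact ⟨_, valueToDiagonal_valueAction Δ a f⟩
  let N : Submodule K A := ⨅ φ : A →ₗ[K] K, R.comap (LinearMap.smulRightₗ φ)
  have hN : ∀ x, x ∈ N ↔ ∀ φ : A →ₗ[K] K, φ.smulRight x ∈ R := by
    intro x
    simp [N, LinearMap.smulRightₗ]
  have h1 : (1 : A) ∈ N := by
    rw [hN]
    exact fun φ ↦ ⟨φ.smulRight 1, by rw [valueToDiagonal_smulRight]; simp⟩
  have hmul : ∀ s ∈ {s : A | Δ s = s ⊗ₜ 1 + 1 ⊗ₜ s}, ∀ a ∈ N, s * a ∈ N := by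
    intro s hs a ha
    rw [hN] at ha ⊢
    intro φ
    have h : (φ.smulRight (s * a) : Module.End K A) = diagonalAction Δ s (φ.smulRight a) -
        (φ ∘ₗ LinearMap.mulRight K s).smulRight a := by
      ext x
      simp [diagonalAction_apply_of_primitive hs]
    rw [h]
    exact R.sub_mem (hR _ _ (ha φ)) (ha _)
  have htop := submodule_eq_top_of_mul_mem_left hΔ h1 hmul
  rw [← LinearMap.range_eq_top, Submodule.eq_top_iff']
  intro f
  have hf : f = ∑ i, ((Module.finBasis K A).coord i).smulRight (f (Module.finBasis K A i)) := by
    refine (Module.finBasis K A).ext fun j ↦ ?_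
    simp [Finsupp.single_apply]
  rw [hf]
  exact R.sum_mem fun i _ ↦ (hN _).mp (htop ▸ Submodule.mem_top) _

/-- The regular module is a direct summand of a coinduced module: it is a summand of `End_K(A)`
with the action on values, which is isomorphic to the diagonal and hence to the coinduced action. -/
theorem exists_coinduced_retraction {Δ : A →ₐ[K] A ⊗[K] A}
    (hΔ : adjoin K {s : A | Δ s = s ⊗ₜ 1 + 1 ⊗ₜ s} = ⊤) :
    ∃ (i : A →ₗ[K] Module.End K A) (r : Module.End K A →ₗ[K] A),
      (∀ a b, i (a * b) = coinducedAction K A a (i b)) ∧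
      (∀ a f, r (coinducedAction K A a f) = a * r f) ∧ ∀ a, r (i a) = a := by
  obtain ⟨φ, hφ⟩ : ∃ φ : A →ₗ[K] K, ∀ a : A, φ 1 • a = a := by
    rcases subsingleton_or_nontrivial A with _ | _
    · exact ⟨0, fun a ↦ Subsingleton.elim _ _⟩
    · obtain ⟨φ, hφ⟩ := Module.Projective.exists_dual_eq_one K (one_ne_zero (α := A))
      exact ⟨φ, fun a ↦ by rw [hφ, one_smul]⟩
  let e : Module.End K A ≃ₗ[K] Module.End K A :=
    (LinearEquiv.ofBijective (valueToDiagonal Δ)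
      ⟨LinearMap.injective_iff_surjective.mpr (valueToDiagonal_surjective hΔ),
        valueToDiagonal_surjective hΔ⟩).trans
    (LinearEquiv.ofInjectiveEndo _ (diagonalToCoinduced_injective hΔ))
  have he : ∀ a f, e (valueAction K A a f) = coinducedAction K A a (e f) := fun a f ↦ by
    change diagonalToCoinduced Δ (valueToDiagonal Δ (valueAction K A a f)) =
      coinducedAction K A a (diagonalToCoinduced Δ (valueToDiagonal Δ f))
    rw [valueToDiagonal_valueAction, diagonalToCoinduced_diagonalAction]
  refine ⟨e.toLinearMap ∘ₗ LinearMap.smulRightₗ φ, LinearMap.applyₗ 1 ∘ₗ e.symm.toLinearMap,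
    fun a b ↦ ?_, fun a f ↦ ?_, fun a ↦ ?_⟩
  · have h : (φ.smulRight (a * b) : Module.End K A) = valueAction K A a (φ.smulRight b) := by
      ext; simp
    simpa [h] using he a (φ.smulRight b)
  · obtain ⟨f, rfl⟩ := e.surjective f
    simp [← he]
  · simpa using hφ a

/-- A finite-dimensional algebra generated by primitive elements is self-injective. -/
theorem baer_of_adjoin_primitive {Δ : A →ₐ[K] A ⊗[K] A}
    (hΔ : adjoin K {s : A | Δ s = s ⊗ₜ 1 + 1 ⊗ₜ s} = ⊤) : Module.Baer A A := by
  intro I g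
  obtain ⟨i, r, hi, hr, hri⟩ := exists_coinduced_retraction hΔ
  -- A linear map into a coinduced module is determined by its composite with evaluation at `1`,
  -- and that composite is merely `K`-linear, so that it extends.
  obtain ⟨G, hG⟩ := LinearMap.exists_extend (p := I.restrictScalars K)
    (LinearMap.applyₗ 1 ∘ₗ i ∘ₗ g.restrictScalars K)
  have hG' : ∀ x (hx : x ∈ I), G x = i (g ⟨x, hx⟩) 1 := fun x hx ↦
    LinearMap.congr_fun hG ⟨x, hx⟩
  refine ⟨{ toFun := fun a ↦ r (G ∘ₗ LinearMap.mulRight K a)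
            map_add' := fun a b ↦ ?_
            map_smul' := fun a b ↦ ?_ }, fun x hx ↦ ?_⟩
  · rw [← map_add]
    congr 1
    ext
    simp [mul_add]
  · rw [smul_eq_mul, RingHom.id_apply, smul_eq_mul, ← hr]
    congr 1
    ext
    simp [mul_assoc]
  · have h : G ∘ₗ LinearMap.mulRight K x = i (g ⟨x, hx⟩) := by
      ext a
      have ha : (⟨a * x, I.mul_mem_left a hx⟩ : I) = a • ⟨x, hx⟩ := rfl
      rw [LinearMap.comp_apply, LinearMap.mulRight_apply, hG' _ (I.mul_mem_left a hx), ha, map_smul,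
        smul_eq_mul, hi, coinducedAction_apply, one_mul]
    simp only [LinearMap.coe_mk, AddHom.coe_mk, h, hri]

end Algebra

/-! ### Injectivity of projective modules over self-injective Noetherian rings -/

namespace Module

variable {R : Type*} [Ring R]

/-- Over a Noetherian ring, Baer's criterion passes from the ring to free modules: a map from
a finitely generated ideal takes values in finitely many coordinates. -/
theorem Baer.finsupp [IsNoetherianRing R] (hR : Module.Baer R R) (ι : Type*) :
    Module.Baer R (ι →₀ R) := by
  classical
  intro I g
  obtain ⟨t, ht⟩ : (⊤ : Submodule R I).FG := IsNoetherian.noetherian _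
  let s : Finset ι := t.sup fun x ↦ (g x).support
  have hs : ∀ x, g x ∈ Finsupp.supported R R (s : Set ι) := by
    have : ⊤ ≤ (Finsupp.supported R R (s : Set ι)).comap g := by
      rw [← ht, Submodule.span_le]
      intro x hx
      simpa [Finsupp.mem_supported] using Finset.le_sup (f := fun x ↦ (g x).support) hx
    exact fun x ↦ this Submodule.mem_top
  choose g' hg' using fun i : ι ↦ hR I (Finsupp.lapply i ∘ₗ g)
  refine ⟨∑ i ∈ s, Finsupp.lsingle i ∘ₗ g' i, fun x hx ↦ ?_⟩
  ext j
  simp only [LinearMap.sum_apply, Finsupp.finsetSum_apply, LinearMap.comp_apply,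
    Finsupp.lsingle_apply, Finsupp.single_apply, Finset.sum_ite_eq']
  split_ifs with hj
  · exact hg' j x hx
  · exact (Finsupp.notMem_support_iff.mp fun h ↦ hj ((Finsupp.mem_supported R _).mp (hs _) h)).symm

/-- Over a Noetherian ring that satisfies Baer's criterion, projective modules do so, too. -/
theorem Baer.of_projective [IsNoetherianRing R] (hR : Module.Baer R R) (P : Type*)
    [AddCommGroup P] [Module R P] [Module.Projective R P] : Module.Baer R P := by
  obtain ⟨s, hs⟩ := Module.projective_def'.mp ‹Module.Projective R P›
  intro I g
  obtain ⟨g', hg'⟩ := hR.finsupp P I (s ∘ₗ g)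
  refine ⟨Finsupp.linearCombination R id ∘ₗ g', fun x hx ↦ ?_⟩
  simpa [hg' x hx] using LinearMap.congr_fun hs (g ⟨x, hx⟩)

end Module

/-! ### Finite dimensionality of algebras with quasi-commuting generators -/

namespace Algebra

variable {K : Type*} [Field K] {A : Type*} [Ring A] [Algebra K A]

theorem list_prod_mem_span_pow {ι : Type*} (b : ι → A) (l : List ι) :
    (l.map b).prod ∈ Submodule.span K (insert 1 (Set.range b)) ^ l.length := by
  induction l with
  | nil => simp [Submodule.one_le.mp le_rfl]
  | cons i l ih =>
    rw [List.map_cons, List.prod_cons, List.length_cons, pow_succ']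
    exact Submodule.mul_mem_mul (Submodule.subset_span (Or.inr ⟨i, rfl⟩)) ih

/-- If the commutators of the `b i` are of degree at most one, then the order of the factors of a
product only matters up to terms of lower degree. -/
theorem list_prod_sub_mem_of_perm {ι : Type*} (b : ι → A)
    (hcomm : ∀ i j, b i * b j - b j * b i ∈ Submodule.span K (insert 1 (Set.range b)))
    {l l' : List ι} (h : l.Perm l') :
    (l.map b).prod - (l'.map b).prod ∈
      Submodule.span K (insert 1 (Set.range b)) ^ (l.length - 1) := by
  induction h with
  | nil => simp
  | @cons i l l' h ih =>
    rcases l with _ | ⟨j, l⟩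
    · simp [h.nil_eq]
    · rw [List.map_cons, List.prod_cons, List.map_cons (l := l'), List.prod_cons, ← mul_sub]
      rw [List.length_cons, Nat.add_sub_cancel] at ih ⊢
      rw [List.length_cons, pow_succ']
      exact Submodule.mul_mem_mul (Submodule.subset_span (Or.inr ⟨i, rfl⟩)) ih
  | swap i j l =>
    simp only [List.map_cons, List.prod_cons, ← mul_assoc, ← sub_mul, List.length_cons,
      Nat.add_sub_cancel]
    rw [pow_succ']
    exact Submodule.mul_mem_mul (hcomm j i) (list_prod_mem_span_pow b l)
  | trans h₁ _ ih₁ ih₂ =>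
    rw [← h₁.length_eq] at ih₂
    simpa using Submodule.add_mem _ ih₁ ih₂

/-- A product of more than `(p - 1) * card ι` factors contains some factor `p` times. Moving these
together and replacing the `p`-th power shows that the product is of lower degree. -/
theorem list_prod_mem_of_length_eq {ι : Type*} [Fintype ι] (b : ι → A) {p : ℕ} (hp : 2 ≤ p)
    (hcomm : ∀ i j, b i * b j - b j * b i ∈ Submodule.span K (insert 1 (Set.range b)))
    (hpow : ∀ i, b i ^ p ∈ Submodule.span K (insert 1 (Set.range b)))
    {l : List ι} (hl : l.length = Fintype.card ι * (p - 1) + 1) :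
    (l.map b).prod ∈
      Submodule.span K (insert 1 (Set.range b)) ^ (Fintype.card ι * (p - 1)) := by
  classical
  obtain ⟨i, hi⟩ : ∃ i, p ≤ l.count i := by
    by_contra! h
    have hsum : ∑ i, l.count i = l.length := by
      simpa using Multiset.sum_count_eq_card (s := Finset.univ) (m := (l : Multiset ι)) (by simp)
    have hle : ∑ i, l.count i ≤ Fintype.card ι * (p - 1) := by
      simpa using Finset.sum_le_sum fun i (_ : i ∈ Finset.univ) ↦ Nat.le_sub_one_of_lt (h i)
    omega
  obtain ⟨l', hl'⟩ := (List.replicate_sublist_iff.mpr hi).exists_perm_append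
  have hlen := hl'.length_eq
  rw [List.length_append, List.length_replicate, hl] at hlen
  have hsub := list_prod_sub_mem_of_perm b hcomm hl'
  rw [hl, Nat.add_sub_cancel] at hsub
  rw [← sub_add_cancel (l.map b).prod]
  refine Submodule.add_mem _ hsub ?_
  rw [List.map_append, List.prod_append, List.map_replicate, List.prod_replicate]
  have hmem := Submodule.mul_mem_mul (hpow i) (list_prod_mem_span_pow (K := K) b l')
  rw [← pow_succ'] at hmem
  have hM1 : 1 ≤ Submodule.span K (insert 1 (Set.range b)) :=
    Submodule.one_le.mpr (Submodule.subset_span (Or.inl rfl))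
  exact (pow_le_pow_right₀ hM1 (by omega) : _ ≤ _) hmem

theorem span_pow_le_span_list_prod {ι : Type*} (b : ι → A) (k : ℕ) :
    Submodule.span K (insert 1 (Set.range b)) ^ k ≤
      Submodule.span K ((fun l : List ι ↦ (l.map b).prod) '' {l | l.length ≤ k}) := by
  induction k with
  | zero =>
    rw [pow_zero, Submodule.one_le]
    exact Submodule.subset_span ⟨[], by simp⟩
  | succ k ih =>
    rw [pow_succ']
    refine (mul_le_mul' le_rfl ih).trans ?_
    rw [Submodule.span_mul_span, Submodule.span_le]
    rintro _ ⟨x, hx, _, ⟨l, hl, rfl⟩, rfl⟩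
    rw [Set.mem_ofPred_eq] at hl
    refine Submodule.subset_span ?_
    rcases hx with rfl | ⟨i, rfl⟩
    · exact ⟨l, hl.trans k.le_succ, by simp⟩
    · exact ⟨i :: l, by simpa using hl, by simp⟩

/-- An algebra is finite-dimensional if it is generated by finitely many elements whose commutators
and `p`-th powers are of degree at most one in the generators. -/
theorem finiteDimensional_of_commutator_of_pow {ι : Type*} [Finite ι] (b : ι → A) {p : ℕ}
    (hp : 2 ≤ p) (hb : adjoin K (Set.range b) = ⊤)
    (hcomm : ∀ i j, b i * b j - b j * b i ∈ Submodule.span K (insert 1 (Set.range b)))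
    (hpow : ∀ i, b i ^ p ∈ Submodule.span K (insert 1 (Set.range b))) :
    FiniteDimensional K A := by
  have := Fintype.ofFinite ι
  set M := Submodule.span K (insert 1 (Set.range b)) with hM
  have hM1 : 1 ≤ M := Submodule.one_le.mpr (Submodule.subset_span (Or.inl rfl))
  have hred : M ^ (Fintype.card ι * (p - 1) + 1) ≤ M ^ (Fintype.card ι * (p - 1)) := by
    refine (span_pow_le_span_list_prod b _).trans (Submodule.span_le.mpr ?_)
    rintro _ ⟨l, hl, rfl⟩
    rcases Nat.le_succ_iff.mp (Set.mem_ofPred_eq ▸ hl) with h | h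
    · exact (pow_le_pow_right₀ hM1 h : _ ≤ _) (list_prod_mem_span_pow b l)
    · exact list_prod_mem_of_length_eq b hp hcomm hpow h
  have htop : M ^ (Fintype.card ι * (p - 1)) = ⊤ := by
    refine submodule_eq_top_of_mul_mem_left hb (Submodule.one_le.mp (one_le_pow₀ hM1)) ?_
    rintro _ ⟨i, rfl⟩ a ha
    refine hred ?_
    rw [pow_succ']
    exact Submodule.mul_mem_mul (Submodule.subset_span (Or.inr ⟨i, rfl⟩)) ha
  exact ⟨htop ▸ (Submodule.fg_span ((Set.finite_range b).insert 1)).pow _⟩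

/-- The binomial formula modulo `p`, without a `CharP` instance on `A` (which may be zero). -/
theorem add_pow_char_of_commute (p : ℕ) [Fact p.Prime] [CharP K p] {x y : A} (h : Commute x y) :
    (x + y) ^ p = x ^ p + y ^ p := by
  obtain ⟨r, hr⟩ := h.exists_add_pow_prime_eq (Fact.out : p.Prime)
  have hp : (p : A) = 0 := by
    rw [← map_natCast (algebraMap K A), CharP.cast_eq_zero, map_zero]
  rw [hr, hp]
  simp

end Algebra

/-! ### The restricted universal enveloping algebra -/

namespace LiePAlgebra

variable (p : ℕ) (K : Type u) (L : Type v) [Field K] [CharP K p]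
  [LieRing L] [LieAlgebra K L] [LiePAlgebra p K L]

section

attribute [local instance] LieRing.ofAssociativeRing

/-- The canonical map `L → u(L)`. -/
noncomputable def toRestricted : L →ₗ[K] RestrictedEnveloping p K L :=
  (RingQuot.mkAlgHom K (RestrictedRel p K L)).toLinearMap ∘ₗ
    (UniversalEnvelopingAlgebra.ι K : L →ₗ⁅K⁆ UniversalEnvelopingAlgebra K L).toLinearMap

theorem toRestricted_apply (x : L) : toRestricted p K L x =
    RingQuot.mkAlgHom K (RestrictedRel p K L) (UniversalEnvelopingAlgebra.ι K x) := rfl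

theorem toRestricted_pow (x : L) :
    toRestricted p K L x ^ p = toRestricted p K L (pMap p K x) := by
  rw [toRestricted_apply, toRestricted_apply, ← map_pow]
  exact RingQuot.mkAlgHom_rel K (RestrictedRel.pow_eq x)

theorem toRestricted_lie (x y : L) : toRestricted p K L ⁅x, y⁆ =
    toRestricted p K L x * toRestricted p K L y - toRestricted p K L y * toRestricted p K L x := by
  simp only [toRestricted_apply, LieHom.map_lie, LieRing.of_associative_ring_bracket, map_sub,
    map_mul]

/-- The corestriction of `ι` to the subalgebra generated by its range extends to `U(L)`, so that the
identity of `U(L)` factors through this subalgebra. -/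
theorem adjoin_range_ι : Algebra.adjoin K (Set.range (UniversalEnvelopingAlgebra.ι K :
    L → UniversalEnvelopingAlgebra K L)) = ⊤ := by
  set S := Algebra.adjoin K (Set.range (UniversalEnvelopingAlgebra.ι K :
    L → UniversalEnvelopingAlgebra K L)) with hS
  let f : L →ₗ⁅K⁆ S :=
    { toFun := fun x ↦ ⟨UniversalEnvelopingAlgebra.ι K x, Algebra.subset_adjoin ⟨x, rfl⟩⟩
      map_add' := fun x y ↦ Subtype.ext (map_add _ x y)
      map_smul' := fun c x ↦ Subtype.ext (map_smul _ c x)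
      map_lie' := fun {x y} ↦ Subtype.ext ((UniversalEnvelopingAlgebra.ι K).map_lie x y) }
  have h : S.val.comp (UniversalEnvelopingAlgebra.lift K f) = AlgHom.id K _ := by
    ext x
    simp [f]
  rw [Algebra.eq_top_iff]
  intro a
  have ha := AlgHom.congr_fun h a
  rw [AlgHom.id_apply] at ha
  rw [← ha]
  exact Subtype.property _

theorem adjoin_range_toRestricted :
    Algebra.adjoin K (Set.range (toRestricted p K L)) = ⊤ := by
  have h := congr_arg (Subalgebra.map (RingQuot.mkAlgHom K (RestrictedRel p K L)))
    (adjoin_range_ι K L)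
  rw [AlgHom.map_adjoin, ← Set.range_comp, Algebra.map_top,
    (AlgHom.range_eq_top _).mpr (RingQuot.mkAlgHom_surjective K _)] at h
  exact h

/-- The Lie algebra map `x ↦ x ⊗ 1 + 1 ⊗ x` from `L` to `u(L) ⊗ u(L)`. -/
noncomputable def comulLie :
    L →ₗ⁅K⁆ RestrictedEnveloping p K L ⊗[K] RestrictedEnveloping p K L where
  toFun x := toRestricted p K L x ⊗ₜ 1 + 1 ⊗ₜ toRestricted p K L x
  map_add' x y := by
    simp only [map_add, TensorProduct.add_tmul, TensorProduct.tmul_add]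
    abel
  map_smul' c x := by
    simp only [map_smul, TensorProduct.smul_tmul', TensorProduct.tmul_smul, smul_add,
      RingHom.id_apply]
  map_lie' {x y} := by
    simp only [LieRing.of_associative_ring_bracket, toRestricted_lie, TensorProduct.sub_tmul,
      TensorProduct.tmul_sub, mul_add, add_mul, Algebra.TensorProduct.tmul_mul_tmul, one_mul,
      mul_one]
    abel

theorem comulLie_apply (x : L) : comulLie p K L x =
    toRestricted p K L x ⊗ₜ 1 + 1 ⊗ₜ toRestricted p K L x := rfl

theorem comulLie_pow [Fact p.Prime] (x : L) :
    comulLie p K L x ^ p = comulLie p K L (pMap p K x) := by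
  have h : Commute (toRestricted p K L x ⊗ₜ[K] (1 : RestrictedEnveloping p K L))
      (1 ⊗ₜ[K] toRestricted p K L x) := by
    simp [Commute, SemiconjBy]
  rw [comulLie_apply, Algebra.add_pow_char_of_commute (K := K) p h, Algebra.TensorProduct.tmul_pow,
    Algebra.TensorProduct.tmul_pow, one_pow, toRestricted_pow, comulLie_apply]

/-- The comultiplication of `u(L)`, for which the elements of `L` are primitive. -/
noncomputable def comul [Fact p.Prime] : RestrictedEnveloping p K L →ₐ[K]
    RestrictedEnveloping p K L ⊗[K] RestrictedEnveloping p K L :=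
  RingQuot.liftAlgHom K ⟨UniversalEnvelopingAlgebra.lift K (comulLie p K L), by
    rintro _ _ ⟨x⟩
    rw [map_pow, UniversalEnvelopingAlgebra.lift_ι_apply, UniversalEnvelopingAlgebra.lift_ι_apply,
      comulLie_pow]⟩

theorem comul_toRestricted [Fact p.Prime] (x : L) : comul p K L (toRestricted p K L x) =
    toRestricted p K L x ⊗ₜ 1 + 1 ⊗ₜ toRestricted p K L x := by
  rw [comul, toRestricted_apply, RingQuot.liftAlgHom_mkAlgHom_apply,
    UniversalEnvelopingAlgebra.lift_ι_apply]
  rfl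

end

instance [Fact p.Prime] [FiniteDimensional K L] :
    FiniteDimensional K (RestrictedEnveloping p K L) := by
  let B := Module.finBasis K L
  have hspan : ∀ x : L, toRestricted p K L x ∈
      Submodule.span K (Set.range (toRestricted p K L ∘ B)) := by
    intro x
    rw [Set.range_comp, ← Submodule.map_span, B.span_eq]
    exact Submodule.mem_map_of_mem Submodule.mem_top
  have hspan' : ∀ x : L, toRestricted p K L x ∈
      Submodule.span K (insert 1 (Set.range (toRestricted p K L ∘ B))) := fun x ↦
    Submodule.span_mono (Set.subset_insert _ _) (hspan x)
  refine Algebra.finiteDimensional_of_commutator_of_pow (toRestricted p K L ∘ B)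
    (Fact.out : p.Prime).two_le ?_ (fun i j ↦ ?_) (fun i ↦ ?_)
  · rw [eq_top_iff, ← adjoin_range_toRestricted p K L]
    refine Algebra.adjoin_le ?_
    rintro _ ⟨x, rfl⟩
    exact Algebra.span_le_adjoin K _ (hspan x)
  · rw [Function.comp_apply, Function.comp_apply, ← toRestricted_lie]
    exact hspan' _
  · rw [Function.comp_apply, toRestricted_pow]
    exact hspan' _

open MulOpposite in
/-- `u(L)` is injective as a right module over itself. -/
theorem baer_restrictedEnveloping_op [Fact p.Prime] [FiniteDimensional K L] :
    Module.Baer (RestrictedEnveloping p K L)ᵐᵒᵖ (RestrictedEnveloping p K L)ᵐᵒᵖ := by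
  let Δ := (Algebra.TensorProduct.opAlgEquiv K K (RestrictedEnveloping p K L)
    (RestrictedEnveloping p K L)).symm.toAlgHom.comp (AlgHom.op (comul p K L))
  refine Algebra.baer_of_adjoin_primitive (Δ := Δ) ?_
  set T := Algebra.adjoin K {s | Δ s = s ⊗ₜ 1 + 1 ⊗ₜ s}
  have hT : T.unop = ⊤ := by
    rw [eq_top_iff, ← adjoin_range_toRestricted p K L]
    refine Algebra.adjoin_le ?_
    rintro _ ⟨x, rfl⟩
    refine Algebra.subset_adjoin (?_ : Δ _ = _)
    simp [Δ, comul_toRestricted]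
  rw [← T.op_unop, hT, Subalgebra.op_top]

/-- Projective right `u(L)`-modules are injective. -/
theorem injective_of_projective [Fact p.Prime] [FiniteDimensional K L]
    (P : ModuleCat.{max u v} (RestrictedEnveloping p K L)ᵐᵒᵖ) (hP : Projective P) :
    Injective P := by
  have : IsNoetherianRing (RestrictedEnveloping p K L)ᵐᵒᵖ :=
    isNoetherian_of_tower K inferInstance
  have hP' : Module.Projective (RestrictedEnveloping p K L)ᵐᵒᵖ P :=
    P.projective_of_module_projective
  have := ((baer_restrictedEnveloping_op p K L).of_projective P).injective
  exact Module.injective_object_of_injective_module _ P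

end LiePAlgebra

/-! ### The dichotomy for the restricted cohomological dimension -/

theorem mainTheorem4 (p : ℕ) [Fact p.Prime] (K : Type u) (L : Type v) [Field K] [CharP K p]
    [LieRing L] [LieAlgebra K L] [LiePAlgebra p K L] [FiniteDimensional K L] :
    LiePAlgebra.restrictedCohomologicalDimension p K L = 0 ∨
      LiePAlgebra.restrictedCohomologicalDimension p K L = ⊤ := by
  by_cases h : ∃ n, LiePAlgebra.HasResolutionOfLength p K L n
  · left
    obtain ⟨n, P, hP⟩ := h
    have : Projective (LiePAlgebra.trivialModule p K L) :=
      projective_of_hasProjectiveDimensionLE (LiePAlgebra.injective_of_projective p K L)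
        (P.hasProjectiveDimensionLE hP)
    have h0 : LiePAlgebra.HasResolutionOfLength p K L 0 :=
      ⟨ProjectiveResolution.self _, fun i hi ↦
        HomologicalComplex.isZero_single_obj_X _ _ _ _ hi.ne'⟩
    exact nonpos_iff_eq_zero.mp (iInf₂_le 0 h0)
  · right
    push Not at h
    simp [LiePAlgebra.restrictedCohomologicalDimension, h]
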